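/- All graphs are finite and simple; $n(G)$, $\delta(G)$ and $\Delta(G)$ are the order, minimum degree and maximum degree of $G$, $N(v)$ is the set of neighbours of $v$, and $N[v]=N(v)\cup\{v\}$. A set $S\subseteq V(G)$ is a dominating (perfect dominating) set if every vertex of $V(G)\setminus S$ has at least one (exactly one) neighbour in $S$, and a total dominating set if every vertex of $G$ has a neighbour in $S$; $\gamma(G)$, $\gamma^p(G)$, $\gamma_t(G)$ are the respective minimum cardinalities. $S$ is a packing (open packing) if the sets $N[v]$ (the sets $N(v)$), $v\in S$, are pairwise disjoint; $\rho(G)$ is the maximum cardinality of a packing. $G$ is an efficient closed domination graph if some dominating set of $G$ is a packing, and an efficient open domination graph if there is $D\subseteq V(G)$ such that $\bigcup_{u\in D}N(u)=V(G)$ and the sets $N(u)$, $u\in D$, are pairwise disjoint. A dominating couple is an ordered pair $(A,B)$ of disjoint subsets of $V(G)$ such that every vertex of $V(G)\setminus B$ has a neighbour in $A\cup B$; $\zeta(G)$ is the minimum of $2|A|+3|B|$ over all dominating couples, and a $\zeta(G)$-couple is one attaining it. For $S\subseteq V(G)$ let $S_0$ be the set of isolated vertices of the induced subgraph $G[S]$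 and $S_1=S\setminus S_0$; $\zeta'(G)$ is the minimum of $4|S_0|+2|S_1|$ over all open packings $S$ of $G$ that are dominating sets ($\zeta'(G)=\infty$ if there are none). $\gamma_R(G)$ ($\gamma_R^p(G)$) is the minimum of $\sum_{v\in V(G)}f(v)$ over all $f:V(G)\to\{0,1,2\}$ such that every vertex $u$ with $f(u)=0$ has at least one (exactly one) neighbour $v$ with $f(v)=2$. The lexicographic product $G\circ H$ has vertex set $V(G)\times V(H)$, with $(u,v)$ and $(x,y)$ adjacent iff $ux\in E(G)$, or $u=x$ and $vy\in E(H)$. **Theorem.** Let $G$ be a connected graph with at least two vertices and let $H$ be any graph with $n(H)\ge 3$. 1. If $\Delta(H)=n(H)-1$, then $\gamma_R^p(G\circ H)=\gamma_R(G\circ H)$ if and only if $\gamma(H)=1$ and $G$ is an efficient closed domination graph. 2. If $\Delta(H)=n(H)-2$, then $\gamma_R^p(G\circ H)=\gamma_R(G\circ H)$ if and only if there exists a $\zeta(G)$-couple $(A,B)$ such that $A\cup B$ is an open packing and $A=\varnothing$ whenever $\delta(H)\ge 1$. 3. If $\Delta(H)=n(H)-3$, then $\gamma_R^p(G\circ H)=\gamma_R(G\circ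 H)$ if and only if either $\delta(H)=0$ and $\zeta'(G)=2\gamma_t(G)$, or $\delta(H)\ge 1$ and $\gamma_t(G)=2\gamma^p(G)=2\rho(G)$. 4. If $\Delta(H)\le n(H)-4$, then $\gamma_R^p(G\circ H)=\gamma_R(G\circ H)$ if and only if $\delta(H)=0$ and $G$ is an efficient open domination graph. -/

import Mathlib

/-! Domination, perfect domination, packing and (perfect) Roman domination parameters of finite
simple graphs, and the lexicographic product of two graphs. -/

namespace SimpleGraph

universe u v

variable {V : Type u} {W : Type v}

/-- The lexicographic product `G ∘ H`: `(u, v)` and `(x, y)` are adjacent iff `u ∼ x` in `G`, or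
`u = x` and `v ∼ y` in `H`. -/
def lexProduct (G : SimpleGraph V) (H : SimpleGraph W) : SimpleGraph (V × W) where
  Adj p q := G.Adj p.1 q.1 ∨ (p.1 = q.1 ∧ H.Adj p.2 q.2)
  symm := ⟨fun _ _ h => h.imp (fun h => h.symm) (fun h => ⟨h.1.symm, h.2.symm⟩)⟩
  loopless := ⟨fun p h => h.elim (fun h => G.loopless.irrefl p.1 h)
    (fun h => H.loopless.irrefl p.2 h.2)⟩

/-! ### Dominating sets and packings -/

/-- Every vertex outside `S` is adjacent to at least one vertex in `S`. -/
def IsDominatingSet (G : SimpleGraph V) (S : Finset V) : Prop :=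
  ∀ v, v ∉ S → ∃ u ∈ S, G.Adj v u

/-- Every vertex outside `S` is adjacent to exactly one vertex in `S`. -/
def IsPerfectDominatingSet (G : SimpleGraph V) (S : Finset V) : Prop :=
  ∀ v, v ∉ S → ∃! u, u ∈ S ∧ G.Adj v u

/-- Every vertex is adjacent to at least one vertex in `S`. -/
def IsTotalDominatingSet (G : SimpleGraph V) (S : Finset V) : Prop :=
  ∀ v, ∃ u ∈ S, G.Adj v u

/-- The closed neighbourhood `N[v]`. -/
def closedNeighborSet (G : SimpleGraph V) (v : V) : Set V :=
  insert v (G.neighborSet v)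

/-- `N[u] ∩ N[v] = ∅` for all distinct `u, v ∈ S`. -/
def IsPacking (G : SimpleGraph V) (S : Finset V) : Prop :=
  ∀ u ∈ S, ∀ v ∈ S, u ≠ v → G.closedNeighborSet u ∩ G.closedNeighborSet v = ∅

/-- `N(u) ∩ N(v) = ∅` for all distinct `u, v ∈ S`. -/
def IsOpenPacking (G : SimpleGraph V) (S : Finset V) : Prop :=
  ∀ u ∈ S, ∀ v ∈ S, u ≠ v → G.neighborSet u ∩ G.neighborSet v = ∅

/-- `γ(G)`. -/
noncomputable def dominationNumber (G : SimpleGraph V) : ℕ :=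
  sInf {k | ∃ S : Finset V, G.IsDominatingSet S ∧ S.card = k}

/-- `γ^p(G)`. -/
noncomputable def perfectDominationNumber (G : SimpleGraph V) : ℕ :=
  sInf {k | ∃ S : Finset V, G.IsPerfectDominatingSet S ∧ S.card = k}

/-- `γ_t(G)`; meaningful for graphs without isolated vertices. -/
noncomputable def totalDominationNumber (G : SimpleGraph V) : ℕ :=
  sInf {k | ∃ S : Finset V, G.IsTotalDominatingSet S ∧ S.card = k}

/-- `ρ(G)`, the maximum cardinality of a packing of a finite graph. -/
noncomputable def packingNumber (G : SimpleGraph V) : ℕ :=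
  sSup {k | ∃ S : Finset V, G.IsPacking S ∧ S.card = k}

/-- Some dominating set of `G` is a packing. -/
def IsEfficientClosedDomination (G : SimpleGraph V) : Prop :=
  ∃ S : Finset V, G.IsDominatingSet S ∧ G.IsPacking S

/-- There is a set `D` whose open neighbourhoods cover `V(G)` and are pairwise disjoint. -/
def IsEfficientOpenDomination (G : SimpleGraph V) : Prop :=
  ∃ D : Finset V, (⋃ u ∈ D, G.neighborSet u) = Set.univ ∧
    ∀ u ∈ D, ∀ v ∈ D, u ≠ v → G.neighborSet u ∩ G.neighborSet v = ∅

/-! ### The parameters `ζ` and `ζ'` -/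

/-- `A` and `B` are disjoint and every vertex outside `B` has a neighbour in `A ∪ B`. -/
def IsDominatingCouple (G : SimpleGraph V) (A B : Finset V) : Prop :=
  Disjoint A B ∧ ∀ x, x ∉ B → ∃ y, (y ∈ A ∨ y ∈ B) ∧ G.Adj x y

/-- `ζ(G)`, the minimum of `2|A| + 3|B|` over all dominating couples `(A, B)`. -/
noncomputable def zeta (G : SimpleGraph V) : ℕ :=
  sInf {k | ∃ A B : Finset V, G.IsDominatingCouple A B ∧ 2 * A.card + 3 * B.card = k}

/-- A dominating couple that attains `ζ(G)`. -/
def IsZetaCouple (G : SimpleGraph V) (A B : Finset V) : Prop :=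
  G.IsDominatingCouple A B ∧ G.zeta = 2 * A.card + 3 * B.card

open Classical in
/-- `S₀`, the set of isolated vertices of the induced subgraph `G[S]`. -/
noncomputable def isolatedPart (G : SimpleGraph V) (S : Finset V) : Finset V :=
  S.filter fun v => ∀ u ∈ S, ¬ G.Adj v u

open Classical in
/-- `S₁ = S \ S₀`. -/
noncomputable def nonisolatedPart (G : SimpleGraph V) (S : Finset V) : Finset V :=
  S \ G.isolatedPart S

/-- `ζ'(G)`, the minimum of `4|S₀| + 2|S₁|` over all dominating open packings `S`. A graph may have
no such set, and then the value is `⊤`. -/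
noncomputable def zetaPrime (G : SimpleGraph V) : ℕ∞ :=
  ⨅ (S : Finset V) (_ : G.IsOpenPacking S ∧ G.IsDominatingSet S),
    ((4 * (G.isolatedPart S).card + 2 * (G.nonisolatedPart S).card : ℕ) : ℕ∞)

/-! ### Roman domination -/

/-- Every vertex of label `0` is adjacent to at least one vertex of label `2`. -/
def IsRomanDominating (G : SimpleGraph V) (f : V → Fin 3) : Prop :=
  ∀ u, f u = 0 → ∃ v, G.Adj u v ∧ f v = 2

/-- Every vertex of label `0` is adjacent to exactly one vertex of label `2`. -/
def IsPerfectRomanDominating (G : SimpleGraph V) (f : V → Fin 3) : Prop :=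
  ∀ u, f u = 0 → ∃! v, G.Adj u v ∧ f v = 2

/-- `γ_R(G)`. -/
noncomputable def romanDominationNumber [Fintype V] (G : SimpleGraph V) : ℕ :=
  sInf {k | ∃ f : V → Fin 3, G.IsRomanDominating f ∧ ∑ v, (f v : ℕ) = k}

/-- `γ_R^p(G)`. -/
noncomputable def perfectRomanDominationNumber [Fintype V] (G : SimpleGraph V) : ℕ :=
  sInf {k | ∃ f : V → Fin 3, G.IsPerfectRomanDominating f ∧ ∑ v, (f v : ℕ) = k}

/-! ### The properties `P₁` and `P₂` -/

/-- `δ(H) = 0` and `G` is an efficient open domination graph. -/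
def PropertyOne (G : SimpleGraph V) (H : SimpleGraph W) [Fintype W] [DecidableRel H.Adj] : Prop :=
  H.minDegree = 0 ∧ G.IsEfficientOpenDomination

/-- `γ(H) = 1` and `G` is an efficient closed domination graph. -/
def PropertyTwo (G : SimpleGraph V) (H : SimpleGraph W) : Prop :=
  H.dominationNumber = 1 ∧ G.IsEfficientClosedDomination

end SimpleGraph

namespace SimpleGraph

universe u v

variable {V : Type u} {W : Type v}

/-! ### Labels on a single graph -/

lemma add_le_sum_label [Fintype W] (φ : W → Fin 3) {a b : W} (h : a ≠ b) :
    (φ a : ℕ) + φ b ≤ ∑ w, (φ w : ℕ) := by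
  classical
  rw [← Finset.sum_pair (f := fun w => (φ w : ℕ)) h]
  exact Finset.sum_le_sum_of_subset (Finset.subset_univ _)

lemma label_le_sum [Fintype W] (φ : W → Fin 3) (a : W) :
    (φ a : ℕ) ≤ ∑ w, (φ w : ℕ) :=
  Finset.single_le_sum (f := fun w => (φ w : ℕ)) (fun _ _ => Nat.zero_le _) (Finset.mem_univ a)

lemma exists_label_eq_zero [Fintype W] (φ : W → Fin 3)
    (h : ∑ w, (φ w : ℕ) < Fintype.card W) : ∃ w, φ w = 0 := by
  by_contra! hne
  have : ∑ _w : W, 1 ≤ ∑ w, (φ w : ℕ) := Finset.sum_le_sum fun w _ => by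
    have := hne w
    omega
  simp at this
  omega

lemma eq_zero_of_sum_le_two [Fintype W] (φ : W → Fin 3) {a b : W} (ha : φ a = 2)
    (h : ∑ w, (φ w : ℕ) ≤ 2) (hab : a ≠ b) : φ b = 0 := by
  have := add_le_sum_label φ hab
  rw [ha] at this
  have h2 : ((2 : Fin 3) : ℕ) = 2 := rfl
  omega

open Classical in
/-- The label `2` at `a`, `0` at the neighbours of `a`, and `1` at all other vertices. -/
noncomputable def starLabel (H : SimpleGraph W) (a w : W) : Fin 3 :=
  if w = a then 2 else if H.Adj a w then 0 else 1

lemma starLabel_eq_zero {H : SimpleGraph W} {a w : W} : H.starLabel a w = 0 ↔ H.Adj a w := by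
  unfold starLabel
  split_ifs with h1 h2
  · subst h1; simp
  · simp [h2]
  · simp [h2]

lemma starLabel_eq_two {H : SimpleGraph W} {a w : W} : H.starLabel a w = 2 ↔ w = a := by
  unfold starLabel
  split_ifs with h1 h2 <;> simp [h1]

lemma sum_starLabel_add_degree [Fintype W] (H : SimpleGraph W) [DecidableRel H.Adj] (a : W) :
    ∑ w, (H.starLabel a w : ℕ) + H.degree a = Fintype.card W + 1 := by
  classical
  have hdeg : H.degree a = ∑ w, if H.Adj a w then 1 else 0 := by
    rw [← H.card_neighborFinset_eq_degree, H.neighborFinset_eq_filter, Finset.card_filter]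
  have hone : Fintype.card W + 1 = ∑ w, (1 + if w = a then 1 else 0) := by
    simp [Finset.sum_add_distrib]
  rw [hdeg, hone, ← Finset.sum_add_distrib]
  refine Finset.sum_congr rfl fun w _ => ?_
  by_cases h1 : w = a
  · subst h1; simp [starLabel]
  · by_cases h2 : H.Adj a w <;> simp [starLabel, h1, h2]

/-- A label of small weight vanishes somewhere outside the closed neighbourhood of a vertex that
has label `2`. -/
lemma exists_not_adj_label_eq_zero [Fintype W] (H : SimpleGraph W) [DecidableRel H.Adj]
    (φ : W → Fin 3) {c : ℕ} {a : W} (ha : φ a = 2) (hc : H.degree a + c ≤ Fintype.card W)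
    (h : ∑ w, (φ w : ℕ) ≤ c) : ∃ w, ¬ H.Adj a w ∧ φ w = 0 := by
  by_contra! hne
  have : ∑ w, (H.starLabel a w : ℕ) ≤ ∑ w, (φ w : ℕ) := Finset.sum_le_sum fun w _ => by
    unfold starLabel
    split_ifs with h1 h2
    · rw [h1, ha]
    · simp
    · have := hne w h2
      simp only [Fin.val_one]
      omega
  have := H.sum_starLabel_add_degree a
  omega

/-! ### Minimum and maximum parameters -/

lemma dominationNumber_le {G : SimpleGraph V} {S : Finset V} (h : G.IsDominatingSet S) :
    G.dominationNumber ≤ S.card := Nat.sInf_le ⟨S, h, rfl⟩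

lemma perfectDominationNumber_le {G : SimpleGraph V} {S : Finset V}
    (h : G.IsPerfectDominatingSet S) : G.perfectDominationNumber ≤ S.card :=
  Nat.sInf_le ⟨S, h, rfl⟩

lemma totalDominationNumber_le {G : SimpleGraph V} {S : Finset V}
    (h : G.IsTotalDominatingSet S) : G.totalDominationNumber ≤ S.card :=
  Nat.sInf_le ⟨S, h, rfl⟩

lemma zeta_le {G : SimpleGraph V} {A B : Finset V} (h : G.IsDominatingCouple A B) :
    G.zeta ≤ 2 * A.card + 3 * B.card := Nat.sInf_le ⟨A, B, h, rfl⟩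

lemma exists_card_eq_dominationNumber [Fintype V] (G : SimpleGraph V) :
    ∃ S : Finset V, G.IsDominatingSet S ∧ S.card = G.dominationNumber :=
  Nat.sInf_mem (s := {k | ∃ S : Finset V, G.IsDominatingSet S ∧ S.card = k})
    ⟨_, Finset.univ, fun v hv => absurd (Finset.mem_univ v) hv, rfl⟩

lemma exists_card_eq_perfectDominationNumber [Fintype V] (G : SimpleGraph V) :
    ∃ S : Finset V, G.IsPerfectDominatingSet S ∧ S.card = G.perfectDominationNumber :=
  Nat.sInf_mem (s := {k | ∃ S : Finset V, G.IsPerfectDominatingSet S ∧ S.card = k})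
    ⟨_, Finset.univ, fun v hv => absurd (Finset.mem_univ v) hv, rfl⟩

lemma exists_card_eq_totalDominationNumber [Fintype V] {G : SimpleGraph V}
    (hG : ∀ x, ∃ y, G.Adj x y) :
    ∃ S : Finset V, G.IsTotalDominatingSet S ∧ S.card = G.totalDominationNumber :=
  Nat.sInf_mem (s := {k | ∃ S : Finset V, G.IsTotalDominatingSet S ∧ S.card = k})
    ⟨_, Finset.univ, fun v => by simpa using hG v, rfl⟩

lemma exists_isZetaCouple [Fintype V] (G : SimpleGraph V) :
    ∃ A B : Finset V, G.IsZetaCouple A B := by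
  obtain ⟨A, B, h, hk⟩ :=
    Nat.sInf_mem (s := {k | ∃ A B : Finset V, G.IsDominatingCouple A B ∧
      2 * A.card + 3 * B.card = k})
      ⟨_, ∅, Finset.univ, ⟨by simp, fun v hv => absurd (Finset.mem_univ v) hv⟩, rfl⟩
  exact ⟨A, B, h, hk.symm⟩

lemma exists_sum_eq_romanDominationNumber [Fintype V] (G : SimpleGraph V) :
    ∃ f, G.IsRomanDominating f ∧ ∑ v, (f v : ℕ) = G.romanDominationNumber :=
  Nat.sInf_mem (s := {k | ∃ f : V → Fin 3, G.IsRomanDominating f ∧ ∑ v, (f v : ℕ) = k})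
    ⟨_, fun _ => 2, fun _ h => by simp at h, rfl⟩

lemma exists_sum_eq_perfectRomanDominationNumber [Fintype V] (G : SimpleGraph V) :
    ∃ f, G.IsPerfectRomanDominating f ∧ ∑ v, (f v : ℕ) = G.perfectRomanDominationNumber :=
  Nat.sInf_mem (s := {k | ∃ f : V → Fin 3, G.IsPerfectRomanDominating f ∧ ∑ v, (f v : ℕ) = k})
    ⟨_, fun _ => 2, fun _ h => by simp at h, rfl⟩

lemma romanDominationNumber_le [Fintype V] {G : SimpleGraph V} {f : V → Fin 3}
    (h : G.IsRomanDominating f) : G.romanDominationNumber ≤ ∑ v, (f v : ℕ) :=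
  Nat.sInf_le ⟨f, h, rfl⟩

lemma perfectRomanDominationNumber_le [Fintype V] {G : SimpleGraph V} {f : V → Fin 3}
    (h : G.IsPerfectRomanDominating f) : G.perfectRomanDominationNumber ≤ ∑ v, (f v : ℕ) :=
  Nat.sInf_le ⟨f, h, rfl⟩

lemma IsPerfectRomanDominating.isRomanDominating {G : SimpleGraph V} {f : V → Fin 3}
    (h : G.IsPerfectRomanDominating f) : G.IsRomanDominating f :=
  fun u hu => (h u hu).exists

lemma romanDominationNumber_le_perfect [Fintype V] (G : SimpleGraph V) :
    G.romanDominationNumber ≤ G.perfectRomanDominationNumber := by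
  obtain ⟨f, hf, hsum⟩ := G.exists_sum_eq_perfectRomanDominationNumber
  exact hsum ▸ romanDominationNumber_le hf.isRomanDominating

/-- If every vertex outside `Q` has a neighbour in `P`, then adding a neighbour of each vertex of
`Q` to `P` gives a total dominating set. -/
lemma totalDominationNumber_le_add {G : SimpleGraph V} (hG : ∀ x, ∃ y, G.Adj x y)
    {P Q : Finset V} (h : ∀ x, x ∉ Q → ∃ y ∈ P, G.Adj x y) :
    G.totalDominationNumber ≤ P.card + Q.card := by
  classical
  choose g hg using hG
  have hT : G.IsTotalDominatingSet (P ∪ Q.image g) := fun x => by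
    by_cases hx : x ∈ Q
    · exact ⟨g x, Finset.mem_union_right _ (Finset.mem_image_of_mem g hx), hg x⟩
    · obtain ⟨y, hy, hxy⟩ := h x hx
      exact ⟨y, Finset.mem_union_left _ hy, hxy⟩
  exact (totalDominationNumber_le hT).trans <| (Finset.card_union_le _ _).trans <|
    Nat.add_le_add_left Finset.card_image_le _

lemma IsOpenPacking.eq_of_adj {G : SimpleGraph V} {S : Finset V} (h : G.IsOpenPacking S)
    {x a b : V} (ha : a ∈ S) (hb : b ∈ S) (hxa : G.Adj x a) (hxb : G.Adj x b) : a = b := by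
  by_contra hab
  have : x ∈ G.neighborSet a ∩ G.neighborSet b := ⟨hxa.symm, hxb.symm⟩
  rw [h a ha b hb hab] at this
  exact this

lemma isOpenPacking_of_eq_of_adj {G : SimpleGraph V} {S : Finset V}
    (h : ∀ x, ∀ a ∈ S, ∀ b ∈ S, G.Adj x a → G.Adj x b → a = b) : G.IsOpenPacking S := by
  intro a ha b hb hab
  by_contra hne
  obtain ⟨x, hxa, hxb⟩ := Set.nonempty_iff_ne_empty.2 hne
  exact hab (h x a ha b hb hxa.symm hxb.symm)

lemma IsPacking.eq_of_mem {G : SimpleGraph V} {S : Finset V} (h : G.IsPacking S) {x a b : V}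
    (ha : a ∈ S) (hb : b ∈ S) (hxa : x = a ∨ G.Adj a x) (hxb : x = b ∨ G.Adj b x) : a = b := by
  by_contra hab
  have : x ∈ G.closedNeighborSet a ∩ G.closedNeighborSet b := ⟨hxa, hxb⟩
  rw [h a ha b hb hab] at this
  exact this

lemma IsPacking.isOpenPacking {G : SimpleGraph V} {S : Finset V} (h : G.IsPacking S) :
    G.IsOpenPacking S :=
  isOpenPacking_of_eq_of_adj fun _ _ ha _ hb hxa hxb =>
    h.eq_of_mem ha hb (Or.inr hxa.symm) (Or.inr hxb.symm)

lemma IsOpenPacking.isPacking {G : SimpleGraph V} {S : Finset V} (h : G.IsOpenPacking S)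
    (hind : ∀ x ∈ S, ∀ y ∈ S, ¬ G.Adj x y) : G.IsPacking S := by
  intro a ha b hb hab
  by_contra hne
  obtain ⟨x, hxa, hxb⟩ := Set.nonempty_iff_ne_empty.2 hne
  rcases hxa with rfl | hxa
  · rcases hxb with rfl | hxb
    · exact hab rfl
    · exact hind b hb x ha hxb
  · rcases hxb with rfl | hxb
    · exact hind a ha x hb hxa
    · exact hab (h.eq_of_adj ha hb (SimpleGraph.Adj.symm hxa) (SimpleGraph.Adj.symm hxb))

lemma IsPacking.not_adj {G : SimpleGraph V} {S : Finset V} (h : G.IsPacking S) {x y : V}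
    (hx : x ∈ S) (hy : y ∈ S) : ¬ G.Adj x y := fun hxy =>
  hxy.ne (h.eq_of_mem hx hy (Or.inr hxy) (Or.inl rfl))

lemma IsPacking.card_le {G : SimpleGraph V} {P D : Finset V} (hP : G.IsPacking P)
    (hD : G.IsDominatingSet D) : P.card ≤ D.card := by
  have key : ∀ x, ∃ y ∈ D, y = x ∨ G.Adj x y := fun x => by
    by_cases hx : x ∈ D
    · exact ⟨x, hx, Or.inl rfl⟩
    · obtain ⟨y, hy, hxy⟩ := hD x hx
      exact ⟨y, hy, Or.inr hxy⟩
  choose g hg hgx using key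
  refine Finset.card_le_card_of_injOn g (fun x _ => hg x) fun a ha b hb hab => ?_
  exact hP.eq_of_mem ha hb (hgx a) (hab ▸ hgx b)

lemma IsOpenPacking.card_le {G : SimpleGraph V} {P D : Finset V} (hP : G.IsOpenPacking P)
    (hD : G.IsTotalDominatingSet D) : P.card ≤ D.card := by
  choose g hg hgx using hD
  refine Finset.card_le_card_of_injOn g (fun x _ => hg x) fun a ha b hb hab => ?_
  exact hP.eq_of_adj ha hb (hgx a).symm (hab ▸ (hgx b).symm)

lemma packingNumber_eq_card {G : SimpleGraph V} {S : Finset V} (hS : G.IsPacking S)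
    (hD : G.IsDominatingSet S) : G.packingNumber = S.card := by
  have hub : ∀ k ∈ {k | ∃ S : Finset V, G.IsPacking S ∧ S.card = k}, k ≤ S.card := by
    rintro _ ⟨P, hP, rfl⟩
    exact hP.card_le hD
  exact le_antisymm (csSup_le ⟨_, S, hS, rfl⟩ hub) (le_csSup ⟨_, hub⟩ ⟨S, hS, rfl⟩)

lemma perfectDominationNumber_eq_card [Fintype V] {G : SimpleGraph V} {S : Finset V}
    (hS : G.IsPacking S) (hD : G.IsDominatingSet S) : G.perfectDominationNumber = S.card := by
  refine le_antisymm (perfectDominationNumber_le fun v hv => ?_) ?_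
  · obtain ⟨y, hy, hvy⟩ := hD v hv
    exact ⟨y, ⟨hy, hvy⟩, fun z hz => hS.isOpenPacking.eq_of_adj hz.1 hy hz.2 hvy⟩
  · obtain ⟨D, hD, hcard⟩ := G.exists_card_eq_perfectDominationNumber
    exact hcard ▸ hS.card_le fun v hv => (hD v hv).exists

lemma dominationNumber_eq_card [Fintype V] {G : SimpleGraph V} {S : Finset V}
    (hS : G.IsPacking S) (hD : G.IsDominatingSet S) : G.dominationNumber = S.card := by
  refine le_antisymm (dominationNumber_le hD) ?_
  obtain ⟨D, hD, hcard⟩ := G.exists_card_eq_dominationNumber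
  exact hcard ▸ hS.card_le hD

/-! ### Labels of a lexicographic product that come from a couple of vertex sets -/

open Classical in
/-- The label of the lexicographic product that is the star label of `a` over `B`, has the only
value `2` at `b` over `A`, and is `0` elsewhere. -/
noncomputable def coupleLabel (H : SimpleGraph W) (A B : Finset V) (a b : W) (p : V × W) : Fin 3 :=
  if p.1 ∈ B then H.starLabel a p.2 else if p.1 ∈ A ∧ p.2 = b then 2 else 0

lemma coupleLabel_eq_two {H : SimpleGraph W} {A B : Finset V} (hAB : Disjoint A B) {a b : W}
    {x : V} {w : W} :
    coupleLabel H A B a b (x, w) = 2 ↔ (x ∈ A ∧ w = b) ∨ (x ∈ B ∧ w = a) := by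
  unfold coupleLabel
  have : x ∈ A → x ∉ B := fun h => Finset.disjoint_left.1 hAB h
  by_cases hB : x ∈ B
  · have hA : x ∉ A := fun h => this h hB
    simp [hB, hA, starLabel_eq_two]
  · by_cases hA : x ∈ A ∧ w = b <;> simp [hB, hA]

lemma sum_coupleLabel [Fintype V] [Fintype W] {H : SimpleGraph W} [DecidableRel H.Adj]
    {A B : Finset V} (hAB : Disjoint A B) {a b : W} {c : ℕ} (hc : H.degree a + c = Fintype.card W) :
    ∑ p, (coupleLabel H A B a b p : ℕ) = 2 * A.card + (c + 1) * B.card := by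
  classical
  have hfib : ∀ x : V, ∑ w, (coupleLabel H A B a b (x, w) : ℕ) =
      2 * (if x ∈ A then 1 else 0) + (c + 1) * (if x ∈ B then 1 else 0) := fun x => by
    by_cases hB : x ∈ B
    · have hA : x ∉ A := fun h => Finset.disjoint_left.1 hAB h hB
      have := H.sum_starLabel_add_degree a
      simp only [coupleLabel, hB, hA, if_true, if_false]
      omega
    · by_cases hA : x ∈ A
      · simp only [coupleLabel, hB, hA, if_true, if_false, true_and, apply_ite Fin.val]
        simp
      · simp [coupleLabel, hB, hA]
  rw [Fintype.sum_prod_type, Finset.sum_congr rfl fun x _ => hfib x, Finset.sum_add_distrib,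
    ← Finset.mul_sum, ← Finset.mul_sum]
  simp

lemma exists_two_of_mem_couple {H : SimpleGraph W} {A B : Finset V} (hAB : Disjoint A B)
    {a b : W} {y : V} (hy : y ∈ A ∨ y ∈ B) : ∃ w, coupleLabel H A B a b (y, w) = 2 := by
  rcases hy with h | h
  · exact ⟨b, (coupleLabel_eq_two hAB).2 (Or.inl ⟨h, rfl⟩)⟩
  · exact ⟨a, (coupleLabel_eq_two hAB).2 (Or.inr ⟨h, rfl⟩)⟩

lemma romanDominationNumber_lexProduct_le [Fintype V] [Fintype W] [Nonempty W]
    {G : SimpleGraph V} {H : SimpleGraph W} [DecidableRel H.Adj] {A B : Finset V} {c : ℕ}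
    (hc : H.maxDegree + c = Fintype.card W) (hAB : G.IsDominatingCouple A B) :
    (G.lexProduct H).romanDominationNumber ≤ 2 * A.card + (c + 1) * B.card := by
  obtain ⟨a, ha⟩ := H.exists_maximal_degree_vertex
  rw [← sum_coupleLabel (a := a) (b := a) hAB.1 (ha ▸ hc)]
  refine romanDominationNumber_le ?_
  rintro ⟨x, w⟩ h0
  by_cases hB : x ∈ B
  · refine ⟨(x, a), Or.inr ⟨rfl, ?_⟩, (coupleLabel_eq_two hAB.1).2 (Or.inr ⟨hB, rfl⟩)⟩
    simp only [coupleLabel, hB, if_true, starLabel_eq_zero] at h0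
    exact h0.symm
  · obtain ⟨y, hy, hxy⟩ := hAB.2 x hB
    obtain ⟨z, hz⟩ := exists_two_of_mem_couple (H := H) (a := a) (b := a) hAB.1 hy
    exact ⟨(y, z), Or.inl hxy, hz⟩

lemma perfectRomanDominationNumber_lexProduct_le [Fintype V] [DecidableEq V] [Fintype W]
    [Nonempty W] {G : SimpleGraph V} {H : SimpleGraph W} [DecidableRel H.Adj] {A B : Finset V}
    {c : ℕ} (hc : H.maxDegree + c = Fintype.card W) (hAB : G.IsDominatingCouple A B)
    (hS : G.IsOpenPacking (A ∪ B)) (hB : ∀ x ∈ B, ∀ y ∈ A ∪ B, ¬ G.Adj x y)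
    (hA : 1 ≤ H.minDegree → A = ∅) :
    (G.lexProduct H).perfectRomanDominationNumber ≤ 2 * A.card + (c + 1) * B.card := by
  obtain ⟨a, ha⟩ := H.exists_maximal_degree_vertex
  obtain ⟨b, hb⟩ := H.exists_minimal_degree_vertex
  have hb' : ∀ x ∈ A, ∀ w, ¬ H.Adj w b := fun x hx w hw => by
    have : 0 < H.degree b := H.degree_pos_iff_exists_adj b |>.2 ⟨w, hw.symm⟩
    rw [hA (by omega)] at hx
    exact absurd hx (by simp)
  rw [← sum_coupleLabel (a := a) (b := b) hAB.1 (ha ▸ hc)]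
  refine perfectRomanDominationNumber_le ?_
  rintro ⟨x, w⟩ h0
  by_cases hxB : x ∈ B
  · refine ⟨(x, a), ⟨Or.inr ⟨rfl, ?_⟩, (coupleLabel_eq_two hAB.1).2 (Or.inr ⟨hxB, rfl⟩)⟩, ?_⟩
    · simp only [coupleLabel, hxB, if_true, starLabel_eq_zero] at h0
      exact h0.symm
    · rintro ⟨y, z⟩ ⟨hadj, h2⟩
      rw [coupleLabel_eq_two hAB.1] at h2
      rcases hadj with hxy | ⟨rfl, hwz⟩
      · exact absurd hxy (hB x hxB y (Finset.mem_union.2 (h2.imp And.left And.left)))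
      · rcases h2 with h2 | h2
        · exact absurd hxB (Finset.disjoint_left.1 hAB.1 h2.1)
        · rw [h2.2]
  · obtain ⟨y, hy, hxy⟩ := hAB.2 x hxB
    obtain ⟨z, hz⟩ := exists_two_of_mem_couple (H := H) (a := a) (b := b) hAB.1 hy
    refine ⟨(y, z), ⟨Or.inl hxy, hz⟩, ?_⟩
    rintro ⟨y', z'⟩ ⟨hadj, h2⟩
    rw [coupleLabel_eq_two hAB.1] at h2 hz
    rcases hadj with hxy' | ⟨rfl, hwz⟩
    · obtain rfl : y' = y := hS.eq_of_adj (Finset.mem_union.2 (h2.imp And.left And.left))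
        (Finset.mem_union.2 hy) hxy' hxy
      have : y' ∈ A → y' ∉ B := fun h => Finset.disjoint_left.1 hAB.1 h
      have : z' = z := by
        rcases h2 with h2 | h2 <;> rcases hz with hz | hz
        · rw [h2.2, hz.2]
        · exact absurd hz.1 (this h2.1)
        · exact absurd h2.1 (this hz.1)
        · rw [h2.2, hz.2]
      rw [this]
    · rcases h2 with h2 | h2
      · exact absurd (h2.2 ▸ hwz) (hb' x h2.1 w)
      · exact absurd h2.1 hxB

/-! ### Couples, isolated parts and perfect dominating sets -/

/-- Moving a vertex with a neighbour in the couple from `B` to `A` would lower the weight. -/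
lemma IsZetaCouple.not_adj [DecidableEq V] {G : SimpleGraph V} {A B : Finset V} (h : G.IsZetaCouple A B) {x y : V} (hx : x ∈ B)
    (hy : y ∈ A ∪ B) : ¬ G.Adj x y := fun hxy => by
  have hxA : x ∉ A := Finset.disjoint_right.1 h.1.1 hx
  have hc : G.IsDominatingCouple (insert x A) (B.erase x) := by
    refine ⟨Finset.disjoint_left.2 fun z hz hzB => ?_, fun z hz => ?_⟩
    · rw [Finset.mem_erase] at hzB
      rcases Finset.mem_insert.1 hz with rfl | hzA
      · exact hzB.1 rfl
      · exact Finset.disjoint_left.1 h.1.1 hzA hzB.2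
    · obtain ⟨t, ht, hzt⟩ : ∃ t, (t ∈ A ∨ t ∈ B) ∧ G.Adj z t := by
        rcases eq_or_ne z x with rfl | hzx
        · exact ⟨y, Finset.mem_union.1 hy, hxy⟩
        · exact h.1.2 z fun hzB => hz (Finset.mem_erase.2 ⟨hzx, hzB⟩)
      refine ⟨t, ?_, hzt⟩
      rw [Finset.mem_insert, Finset.mem_erase]
      tauto
  have h1 := zeta_le hc
  have h2 := h.2
  have h3 := Finset.card_erase_add_one hx
  have h4 := Finset.card_insert_of_notMem hxA
  omega

lemma mem_isolatedPart {G : SimpleGraph V} {S : Finset V} {x : V} :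
    x ∈ G.isolatedPart S ↔ x ∈ S ∧ ∀ y ∈ S, ¬ G.Adj x y := by
  simp [isolatedPart]

lemma mem_nonisolatedPart {G : SimpleGraph V} {S : Finset V} {x : V} :
    x ∈ G.nonisolatedPart S ↔ x ∈ S ∧ ∃ y ∈ S, G.Adj x y := by
  simp only [nonisolatedPart, Finset.mem_sdiff, mem_isolatedPart]
  constructor
  · rintro ⟨h1, h2⟩
    refine ⟨h1, ?_⟩
    by_contra! h
    exact h2 ⟨h1, h⟩
  · rintro ⟨h1, y, hy, hxy⟩
    exact ⟨h1, fun h => h.2 y hy hxy⟩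

lemma nonisolatedPart_union_isolatedPart [DecidableEq V] {G : SimpleGraph V} (S : Finset V) :
    G.nonisolatedPart S ∪ G.isolatedPart S = S := by
  ext x
  rw [Finset.mem_union, mem_nonisolatedPart, mem_isolatedPart]
  constructor
  · rintro (h | h) <;> exact h.1
  · intro h
    by_cases hx : ∃ y ∈ S, G.Adj x y
    · exact Or.inl ⟨h, hx⟩
    · push Not at hx
      exact Or.inr ⟨h, hx⟩

lemma disjoint_nonisolatedPart_isolatedPart {G : SimpleGraph V} (S : Finset V) :
    Disjoint (G.nonisolatedPart S) (G.isolatedPart S) :=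
  Finset.disjoint_left.2 fun x h1 h0 => by
    obtain ⟨y, hy, hxy⟩ := (mem_nonisolatedPart.1 h1).2
    exact (mem_isolatedPart.1 h0).2 y hy hxy

lemma isDominatingCouple_isolatedPart {G : SimpleGraph V} {S : Finset V} (hS : G.IsDominatingSet S) :
    G.IsDominatingCouple (G.nonisolatedPart S) (G.isolatedPart S) := by
  classical
  refine ⟨disjoint_nonisolatedPart_isolatedPart S, fun x hx => ?_⟩
  simp only [← Finset.mem_union, nonisolatedPart_union_isolatedPart]
  by_cases hxS : x ∈ S
  · rw [mem_isolatedPart] at hx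
    by_contra! h
    exact hx ⟨hxS, fun y hy => h y hy⟩
  · exact hS x hxS

lemma two_mul_totalDominationNumber_le_isolatedPart {G : SimpleGraph V} (hG : ∀ x, ∃ y, G.Adj x y) {S : Finset V}
    (hS : G.IsDominatingSet S) : 2 * G.totalDominationNumber ≤
      4 * (G.isolatedPart S).card + 2 * (G.nonisolatedPart S).card := by
  classical
  have h := totalDominationNumber_le_add hG (P := S) (Q := G.isolatedPart S) fun x hx => by
    obtain ⟨y, hy, hxy⟩ := (isDominatingCouple_isolatedPart hS).2 x hx
    rw [← Finset.mem_union, nonisolatedPart_union_isolatedPart] at hy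
    exact ⟨y, hy, hxy⟩
  have hcard := Finset.card_union_of_disjoint (disjoint_nonisolatedPart_isolatedPart (G := G) S)
  rw [nonisolatedPart_union_isolatedPart] at hcard
  omega

lemma zetaPrime_eq_two_mul_totalDominationNumber_iff {G : SimpleGraph V}
    (hG : ∀ x, ∃ y, G.Adj x y) :
    G.zetaPrime = ((2 * G.totalDominationNumber : ℕ) : ℕ∞) ↔
      ∃ S : Finset V, G.IsOpenPacking S ∧ G.IsDominatingSet S ∧
        4 * (G.isolatedPart S).card + 2 * (G.nonisolatedPart S).card ≤
          2 * G.totalDominationNumber := by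
  constructor
  · intro h
    by_contra! hlt
    have : ((2 * G.totalDominationNumber + 1 : ℕ) : ℕ∞) ≤ G.zetaPrime :=
      le_iInf₂ fun S hS => Nat.cast_le.2 (hlt S hS.1 hS.2)
    rw [h, Nat.cast_le] at this
    omega
  · rintro ⟨S, hP, hD, hle⟩
    exact le_antisymm ((iInf₂_le S ⟨hP, hD⟩).trans (Nat.cast_le.2 hle))
      (le_iInf₂ fun S hS => Nat.cast_le.2 (two_mul_totalDominationNumber_le_isolatedPart hG hS.2))

/-- If `γ_t = 2γ^p`, then every minimum perfect dominating set is a packing. -/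
lemma IsPerfectDominatingSet.isPacking {G : SimpleGraph V}
    (hG : ∀ x, ∃ y, G.Adj x y) {D : Finset V}
    (hD : G.IsPerfectDominatingSet D) (h : G.totalDominationNumber = 2 * D.card) :
    G.IsPacking D := by
  classical
  have hind : ∀ x ∈ D, ∀ y ∈ D, ¬ G.Adj x y := by
    intro x hx y hy hxy
    have h1 := totalDominationNumber_le_add hG (P := D) (Q := D.erase x) fun z hz => by
      rcases eq_or_ne z x with rfl | hzx
      · exact ⟨y, hy, hxy⟩
      · exact (hD z fun h => hz (Finset.mem_erase.2 ⟨hzx, h⟩)).exists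
    have h2 := Finset.card_erase_add_one hx
    omega
  refine (isOpenPacking_of_eq_of_adj fun x a ha b hb hxa hxb => ?_).isPacking hind
  exact (hD x fun hx => hind x hx a ha hxa).unique ⟨ha, hxa⟩ ⟨hb, hxb⟩

/-! ### Fibres of a label of the lexicographic product -/

/-- The total label of the fibre over `x`. -/
def fiberWeight [Fintype W] (f : V × W → Fin 3) (x : V) : ℕ := ∑ w, (f (x, w) : ℕ)

lemma two_le_fiberWeight [Fintype W] {f : V × W → Fin 3} {x : V} (h : ∃ w, f (x, w) = 2) : 2 ≤ fiberWeight f x := by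
  obtain ⟨w, hw⟩ := h
  have := label_le_sum (fun w => f (x, w)) w
  rwa [hw] at this

lemma exists_eq_zero_of_fiberWeight_lt [Fintype W] {f : V × W → Fin 3} {x : V}
    (h : fiberWeight f x < Fintype.card W) :
    ∃ w, f (x, w) = 0 :=
  exists_label_eq_zero (fun w => f (x, w)) h

open Classical in
/-- The vertices whose fibre has a label `2` and weight at most `c`. -/
noncomputable def lightPart [Fintype V] [Fintype W] (f : V × W → Fin 3) (c : ℕ) : Finset V :=
  {x | (∃ w, f (x, w) = 2) ∧ fiberWeight f x ≤ c}

open Classical in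
/-- The vertices whose fibre has a label `2` and weight more than `c`. -/
noncomputable def heavyPart [Fintype V] [Fintype W] (f : V × W → Fin 3) (c : ℕ) : Finset V :=
  {x | (∃ w, f (x, w) = 2) ∧ c < fiberWeight f x}

open Classical in
/-- The vertices whose fibre is labelled `1` throughout. -/
noncomputable def onesPart [Fintype V] [Fintype W] (f : V × W → Fin 3) : Finset V :=
  {x | ∀ w, f (x, w) = 1}

section Fibers

variable [Fintype V] [Fintype W] {f : V × W → Fin 3} {c : ℕ} {x y : V}

lemma mem_lightPart : x ∈ lightPart f c ↔ (∃ w, f (x, w) = 2) ∧ fiberWeight f x ≤ c := by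
  simp [lightPart]

lemma mem_heavyPart : x ∈ heavyPart f c ↔ (∃ w, f (x, w) = 2) ∧ c < fiberWeight f x := by
  simp [heavyPart]

lemma mem_onesPart : x ∈ onesPart f ↔ ∀ w, f (x, w) = 1 := by
  simp [onesPart]

lemma disjoint_lightPart_heavyPart : Disjoint (lightPart f c) (heavyPart f c) := by
  rw [Finset.disjoint_left]
  intro x hA hB
  exact absurd (mem_lightPart.1 hA).2 (not_le.2 (mem_heavyPart.1 hB).2)

lemma mem_lightPart_union_heavyPart [DecidableEq V] :
    x ∈ lightPart f c ∪ heavyPart f c ↔ ∃ w, f (x, w) = 2 := by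
  rw [Finset.mem_union, mem_lightPart, mem_heavyPart, ← and_or_left]
  exact and_iff_left (le_or_gt _ _)

lemma indicator_le_fiberWeight [DecidableEq V] (hW : 3 ≤ Fintype.card W) (x : V) :
    2 * (if x ∈ lightPart f c then 1 else 0) + (c + 1) * (if x ∈ heavyPart f c then 1 else 0) +
      3 * (if x ∈ onesPart f then 1 else 0) ≤ fiberWeight f x := by
  have : Nonempty W := Fintype.card_pos_iff.1 (by omega)
  by_cases h2 : ∃ w, f (x, w) = 2
  · have hC : x ∉ onesPart f := fun h => by
      obtain ⟨w, hw⟩ := h2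
      rw [mem_onesPart.1 h w] at hw
      exact absurd hw (by decide)
    have := two_le_fiberWeight h2
    by_cases hc : fiberWeight f x ≤ c
    · simp [mem_lightPart, mem_heavyPart, hC, h2, hc, not_lt.2 hc, this]
    · simp [mem_lightPart, mem_heavyPart, hC, h2, hc, not_le.1 hc]
  · by_cases hC : x ∈ onesPart f
    · have hsum : fiberWeight f x = Fintype.card W := by
        simp [fiberWeight, mem_onesPart.1 hC]
      simp [mem_lightPart, mem_heavyPart, hC, h2, hsum, hW]
    · simp [mem_lightPart, mem_heavyPart, hC, h2]

lemma sum_indicator [DecidableEq V] :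
    ∑ x, (2 * (if x ∈ lightPart f c then 1 else 0) +
      (c + 1) * (if x ∈ heavyPart f c then 1 else 0) + 3 * (if x ∈ onesPart f then 1 else 0)) =
      2 * (lightPart f c).card + (c + 1) * (heavyPart f c).card + 3 * (onesPart f).card := by
  simp only [Finset.sum_add_distrib, ← Finset.mul_sum, Finset.sum_boole, Finset.filter_univ_mem,
    Nat.cast_id]

lemma card_parts_le_sum (hW : 3 ≤ Fintype.card W) :
    2 * (lightPart f c).card + (c + 1) * (heavyPart f c).card + 3 * (onesPart f).card ≤
      ∑ p, (f p : ℕ) := by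
  classical
  rw [← sum_indicator, Fintype.sum_prod_type]
  exact Finset.sum_le_sum fun x _ => indicator_le_fiberWeight hW x

lemma fiberWeight_eq_of_sum_le [DecidableEq V] (hW : 3 ≤ Fintype.card W)
    (h : ∑ p, (f p : ℕ) ≤ 2 * (lightPart f c).card + (c + 1) * (heavyPart f c).card)
    (x : V) : fiberWeight f x = 2 * (if x ∈ lightPart f c then 1 else 0) +
      (c + 1) * (if x ∈ heavyPart f c then 1 else 0) := by
  have hle := card_parts_le_sum (f := f) (c := c) hW
  have hC : onesPart f = ∅ := Finset.card_eq_zero.1 (by omega)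
  have hsum := sum_indicator (f := f) (c := c)
  rw [Fintype.sum_prod_type] at h hle
  have := (Finset.sum_eq_sum_iff_of_le (s := Finset.univ)
    fun x _ => indicator_le_fiberWeight (f := f) (c := c) hW x).1
      (by rw [hsum]; exact le_antisymm hle (by rw [hC]; exact h)) x (Finset.mem_univ x)
  simpa [hC] using this.symm

lemma fiberWeight_le_two_of_sum_le (hW : 3 ≤ Fintype.card W)
    (h : ∑ p, (f p : ℕ) ≤ 2 * (lightPart f c).card + (c + 1) * (heavyPart f c).card)
    (hx : x ∉ heavyPart f c) : fiberWeight f x ≤ 2 := by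
  classical
  rw [fiberWeight_eq_of_sum_le hW h x]
  split_ifs <;> simp

lemma fiberWeight_eq_of_mem_heavyPart (hW : 3 ≤ Fintype.card W)
    (h : ∑ p, (f p : ℕ) ≤ 2 * (lightPart f c).card + (c + 1) * (heavyPart f c).card)
    (hx : x ∈ heavyPart f c) : fiberWeight f x = c + 1 := by
  classical
  have hA : x ∉ lightPart f c := Finset.disjoint_right.1 disjoint_lightPart_heavyPart hx
  rw [fiberWeight_eq_of_sum_le hW h x]
  simp [hx, hA]

variable {G : SimpleGraph V} {H : SimpleGraph W}

lemma exists_adj_of_notMem_heavyPart [DecidableEq V] [DecidableRel H.Adj]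
    (hf : (G.lexProduct H).IsRomanDominating f) (hc : H.maxDegree + c ≤ Fintype.card W)
    (hc3 : c ≤ 3) (hB : x ∉ heavyPart f c) (hC : x ∉ onesPart f) :
    ∃ y ∈ lightPart f c ∪ heavyPart f c, G.Adj x y := by
  by_cases h2 : ∃ w, f (x, w) = 2
  · have hw : fiberWeight f x ≤ c := by
      by_contra h
      exact hB (mem_heavyPart.2 ⟨h2, not_le.1 h⟩)
    obtain ⟨a, ha⟩ := h2
    have := H.degree_le_maxDegree a
    obtain ⟨w, hwa, hw0⟩ := H.exists_not_adj_label_eq_zero (fun w => f (x, w)) ha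
      (show H.degree a + c ≤ _ by omega) hw
    obtain ⟨⟨y, z⟩, hadj, hyz⟩ := hf (x, w) hw0
    rcases hadj with hxy | ⟨rfl, hwz⟩
    · exact ⟨y, mem_lightPart_union_heavyPart.2 ⟨z, hyz⟩, hxy⟩
    · exfalso
      have haz : a ≠ z := fun h => hwa (h ▸ hwz.symm)
      have := add_le_sum_label (fun w => f (x, w)) haz
      simp only [ha, hyz] at this
      have h4 : ((2 : Fin 3) : ℕ) = 2 := rfl
      unfold fiberWeight at hw
      omega
  · obtain ⟨w, hw⟩ : ∃ w, f (x, w) = 0 := by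
      by_contra! h0
      refine hC (mem_onesPart.2 fun w => ?_)
      have h1 := h0 w
      have h2 : f (x, w) ≠ 2 := fun h => h2 ⟨w, h⟩
      omega
    obtain ⟨⟨y, z⟩, hadj, hyz⟩ := hf (x, w) hw
    rcases hadj with hxy | ⟨rfl, -⟩
    · exact ⟨y, mem_lightPart_union_heavyPart.2 ⟨z, hyz⟩, hxy⟩
    · exact absurd ⟨z, hyz⟩ h2

/-- Two distinct neighbours with a label `2` dominate a vertex of label `0` twice. -/
lemma isOpenPacking_of_isPerfectRomanDominating [DecidableEq V]
    (hf : (G.lexProduct H).IsPerfectRomanDominating f)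
    (h : ∀ x, fiberWeight f x < Fintype.card W ∨
      ∀ y ∈ lightPart f c ∪ heavyPart f c, ¬ G.Adj x y) :
    G.IsOpenPacking (lightPart f c ∪ heavyPart f c) := by
  refine isOpenPacking_of_eq_of_adj fun x a ha b hb hxa hxb => ?_
  rcases h x with hw | hx
  · obtain ⟨w, hw⟩ := exists_eq_zero_of_fiberWeight_lt hw
    obtain ⟨z, hz⟩ := mem_lightPart_union_heavyPart.1 ha
    obtain ⟨z', hz'⟩ := mem_lightPart_union_heavyPart.1 hb
    exact congrArg Prod.fst ((hf (x, w) hw).unique ⟨Or.inl hxa, hz⟩ ⟨Or.inl hxb, hz'⟩)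
  · exact absurd hxa (hx a ha)

lemma not_adj_of_fiberWeight_le_two [DecidableEq V] [DecidableRel H.Adj]
    (hf : (G.lexProduct H).IsPerfectRomanDominating f) (hδ : 1 ≤ H.minDegree)
    (hx : x ∈ lightPart f c ∪ heavyPart f c) (hw : fiberWeight f x ≤ 2)
    (hy : y ∈ lightPart f c ∪ heavyPart f c) : ¬ G.Adj x y := fun hxy => by
  obtain ⟨a, ha⟩ := mem_lightPart_union_heavyPart.1 hx
  obtain ⟨z, hz⟩ := mem_lightPart_union_heavyPart.1 hy
  have := H.minDegree_le_degree a
  obtain ⟨w, hwa⟩ := (H.degree_pos_iff_exists_adj a).1 (by omega)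
  have h0 : f (x, w) = 0 := eq_zero_of_sum_le_two (fun w => f (x, w)) ha hw hwa.ne
  exact hxy.ne (congrArg Prod.fst
    ((hf (x, w) h0).unique (y₁ := (x, a)) (y₂ := (y, z))
      ⟨Or.inr ⟨rfl, hwa.symm⟩, ha⟩ ⟨Or.inl hxy, hz⟩))

lemma minDegree_eq_zero_of_adj [DecidableEq V] [DecidableRel H.Adj]
    (hf : (G.lexProduct H).IsPerfectRomanDominating f)
    (hx : x ∈ lightPart f c ∪ heavyPart f c) (hw : fiberWeight f x ≤ 2)
    (hy : y ∈ lightPart f c ∪ heavyPart f c) (hxy : G.Adj x y) : H.minDegree = 0 := by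
  by_contra h
  exact not_adj_of_fiberWeight_le_two hf (Nat.one_le_iff_ne_zero.2 h) hx hw hy hxy

end Fibers

section Product

variable [Fintype V] [DecidableEq V] [Fintype W] {G : SimpleGraph V} {H : SimpleGraph W}
  [DecidableRel H.Adj]

/-! ### Maximum degree `n(H) - 1` -/

lemma dominationNumber_le_card_parts {f : V × W → Fin 3}
    (hf : (G.lexProduct H).IsRomanDominating f) (hΔ : H.maxDegree + 1 ≤ Fintype.card W) :
    G.dominationNumber ≤
      (lightPart f 1).card + (heavyPart f 1).card + (onesPart f).card := by
  have hD : G.IsDominatingSet (lightPart f 1 ∪ heavyPart f 1 ∪ onesPart f) := fun x hx => by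
    simp only [Finset.mem_union, not_or] at hx
    obtain ⟨y, hy, hxy⟩ := exists_adj_of_notMem_heavyPart hf hΔ (by omega) hx.1.2 hx.2
    exact ⟨y, Finset.mem_union_left _ hy, hxy⟩
  exact (dominationNumber_le hD).trans <| (Finset.card_union_le _ _).trans <|
    Nat.add_le_add_right (Finset.card_union_le _ _) _

lemma romanDominationNumber_lexProduct_eq_two_mul_dominationNumber (hW : 3 ≤ Fintype.card W)
    (hΔ : H.maxDegree + 1 = Fintype.card W) :
    (G.lexProduct H).romanDominationNumber = 2 * G.dominationNumber := by
  have : Nonempty W := Fintype.card_pos_iff.1 (by omega)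
  apply le_antisymm
  · obtain ⟨S, hS, hcard⟩ := G.exists_card_eq_dominationNumber
    have hc : G.IsDominatingCouple ∅ S :=
      ⟨Finset.disjoint_empty_left _, fun x hx => by simpa using hS x hx⟩
    simpa [hcard] using romanDominationNumber_lexProduct_le hΔ hc
  · obtain ⟨f, hf, hsum⟩ := (G.lexProduct H).exists_sum_eq_romanDominationNumber
    have h1 := card_parts_le_sum (f := f) (c := 1) hW
    have h2 := dominationNumber_le_card_parts hf hΔ.le
    omega

lemma dominationNumber_eq_one_of_maxDegree_add_one [Nonempty W]
    (hΔ : H.maxDegree + 1 = Fintype.card W) : H.dominationNumber = 1 := by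
  classical
  obtain ⟨a, ha⟩ := H.exists_maximal_degree_vertex
  have hsum := H.sum_starLabel_add_degree a
  refine le_antisymm (dominationNumber_le (S := {a}) fun w hw => ?_) ?_
  · rw [Finset.mem_singleton] at hw
    refine ⟨a, Finset.mem_singleton_self a, ?_⟩
    refine (starLabel_eq_zero.1 (eq_zero_of_sum_le_two (H.starLabel a)
      (starLabel_eq_two.2 rfl) ?_ (Ne.symm hw))).symm
    omega
  · obtain ⟨S, hS, hcard⟩ := H.exists_card_eq_dominationNumber
    rw [← hcard, Nat.one_le_iff_ne_zero, Finset.card_ne_zero]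
    by_contra h
    rw [Finset.not_nonempty_iff_eq_empty] at h
    obtain ⟨y, hy, -⟩ := hS a (by simp [h])
    simp [h] at hy

lemma one_le_minDegree_of_maxDegree_add_one (hW : 2 ≤ Fintype.card W)
    (hΔ : H.maxDegree + 1 = Fintype.card W) : 1 ≤ H.minDegree := by
  classical
  have : Nonempty W := Fintype.card_pos_iff.1 (by omega)
  obtain ⟨a, ha⟩ := H.exists_maximal_degree_vertex
  have hsum := H.sum_starLabel_add_degree a
  refine H.le_minDegree_of_forall_le_degree 1 fun w => ?_
  rcases eq_or_ne a w with rfl | hw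
  · omega
  · refine (H.degree_pos_iff_exists_adj w).2 ⟨a, ?_⟩
    refine (starLabel_eq_zero.1 (eq_zero_of_sum_le_two (H.starLabel a)
      (starLabel_eq_two.2 rfl) ?_ hw)).symm
    omega

theorem perfectRoman_eq_roman_iff_of_maxDegree_add_one (hW : 3 ≤ Fintype.card W)
    (hΔ : H.maxDegree + 1 = Fintype.card W) :
    (G.lexProduct H).perfectRomanDominationNumber = (G.lexProduct H).romanDominationNumber ↔
      G.PropertyTwo H := by
  have : Nonempty W := Fintype.card_pos_iff.1 (by omega)
  have hR := romanDominationNumber_lexProduct_eq_two_mul_dominationNumber (G := G) hW hΔ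
  constructor
  · intro heq
    refine ⟨dominationNumber_eq_one_of_maxDegree_add_one hΔ, ?_⟩
    obtain ⟨f, hf, hsum⟩ := (G.lexProduct H).exists_sum_eq_perfectRomanDominationNumber
    have h1 := card_parts_le_sum (f := f) (c := 1) hW
    have h2 := dominationNumber_le_card_parts hf.isRomanDominating hΔ.le
    have hC : onesPart f = ∅ := Finset.card_eq_zero.1 (by omega)
    have hle : ∑ p, (f p : ℕ) ≤
        2 * (lightPart f 1).card + (1 + 1) * (heavyPart f 1).card := by omega
    have hw : ∀ x, fiberWeight f x ≤ 2 := fun x => by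
      by_cases hx : x ∈ heavyPart f 1
      · exact (fiberWeight_eq_of_mem_heavyPart hW hle hx).le
      · exact fiberWeight_le_two_of_sum_le hW hle hx
    refine ⟨lightPart f 1 ∪ heavyPart f 1, fun x hx => ?_, ?_⟩
    · exact exists_adj_of_notMem_heavyPart hf.isRomanDominating hΔ.le (by omega)
        (fun h => hx (Finset.mem_union_right _ h)) (by simp [hC])
    · refine (isOpenPacking_of_isPerfectRomanDominating hf fun x => Or.inl ?_).isPacking ?_
      · have := hw x
        omega
      · exact fun x hx y hy => not_adj_of_fiberWeight_le_two hf
          (one_le_minDegree_of_maxDegree_add_one (by omega) hΔ) hx (hw x) hy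
  · rintro ⟨-, S, hD, hP⟩
    refine le_antisymm ?_ (romanDominationNumber_le_perfect _)
    have hc : G.IsDominatingCouple ∅ S :=
      ⟨Finset.disjoint_empty_left _, fun x hx => by simpa using hD x hx⟩
    have := perfectRomanDominationNumber_lexProduct_le hΔ hc (by simpa using hP.isOpenPacking)
      (fun x hx y hy => hP.not_adj hx (by simpa using hy)) (fun _ => rfl)
    rw [hR, dominationNumber_eq_card hP hD]
    simpa using this

/-! ### Maximum degree `n(H) - 2` -/

lemma isDominatingCouple_parts {f : V × W → Fin 3}
    (hf : (G.lexProduct H).IsRomanDominating f) (hΔ : H.maxDegree + 2 ≤ Fintype.card W) :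
    G.IsDominatingCouple (lightPart f 2) (heavyPart f 2 ∪ onesPart f) := by
  have hAC : Disjoint (lightPart f 2) (onesPart f) := Finset.disjoint_left.2 fun x hA hC => by
    obtain ⟨w, hw⟩ := (mem_lightPart.1 hA).1
    rw [mem_onesPart.1 hC w] at hw
    exact absurd hw (by decide)
  refine ⟨Finset.disjoint_union_right.2 ⟨disjoint_lightPart_heavyPart, hAC⟩, fun x hx => ?_⟩
  rw [Finset.mem_union, not_or] at hx
  obtain ⟨y, hy, hxy⟩ := exists_adj_of_notMem_heavyPart hf hΔ (by omega) hx.1 hx.2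
  refine ⟨y, ?_, hxy⟩
  rw [Finset.mem_union] at hy ⊢
  tauto

lemma romanDominationNumber_lexProduct_eq_zeta (hW : 3 ≤ Fintype.card W)
    (hΔ : H.maxDegree + 2 = Fintype.card W) :
    (G.lexProduct H).romanDominationNumber = G.zeta := by
  have : Nonempty W := Fintype.card_pos_iff.1 (by omega)
  apply le_antisymm
  · obtain ⟨A, B, hAB, hz⟩ := G.exists_isZetaCouple
    rw [hz]
    exact romanDominationNumber_lexProduct_le hΔ hAB
  · obtain ⟨f, hf, hsum⟩ := (G.lexProduct H).exists_sum_eq_romanDominationNumber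
    have h1 := card_parts_le_sum (f := f) (c := 2) hW
    have h2 := zeta_le (isDominatingCouple_parts hf hΔ.le)
    have h3 := Finset.card_union_le (heavyPart f 2) (onesPart f)
    omega

/-- In a `ζ`-couple of the parts of a label, no fibre is labelled `1` throughout: a neighbour of its
base vertex would do instead. -/
lemma onesPart_eq_empty_of_isZetaCouple (hG : ∀ x, ∃ y, G.Adj x y) {f : V × W → Fin 3}
    (hf : (G.lexProduct H).IsRomanDominating f) (hΔ : H.maxDegree + 2 ≤ Fintype.card W)
    (h : 2 * (lightPart f 2).card + 3 * (heavyPart f 2).card + 3 * (onesPart f).card ≤ G.zeta) :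
    onesPart f = ∅ := by
  by_contra hne
  obtain ⟨x, hx⟩ := Finset.nonempty_iff_ne_empty.2 hne
  have hcpl := isDominatingCouple_parts hf hΔ
  set A := lightPart f 2
  set B := heavyPart f 2
  set C := onesPart f
  have hdom : ∀ z, z ∉ B → z ∉ C → ∃ t, (t ∈ A ∨ t ∈ B) ∧ G.Adj z t := fun z hB hC => by
    simpa [A, B] using exists_adj_of_notMem_heavyPart hf hΔ (by omega) hB hC
  have h3 := Finset.card_erase_add_one hx
  obtain ⟨y, hxy⟩ := hG x
  by_cases hy : y ∈ A ∪ (B ∪ C)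
  · have hc : G.IsDominatingCouple A (B ∪ C.erase x) := by
      refine ⟨hcpl.1.mono_right
        (Finset.union_subset_union_right (Finset.erase_subset _ _)), fun z hz => ?_⟩
      simp only [Finset.mem_union, Finset.mem_erase, not_or, not_and, ne_eq] at hz hy ⊢
      rcases eq_or_ne z x with rfl | hzx
      · exact ⟨y, by have := hxy.ne'; tauto, hxy⟩
      · obtain ⟨t, ht, hzt⟩ := hdom z hz.1 (hz.2 hzx)
        exact ⟨t, by tauto, hzt⟩
    have h1 := zeta_le hc
    have h2 := Finset.card_union_le B (C.erase x)
    omega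
  · have hc : G.IsDominatingCouple (insert y A) (B ∪ C.erase x) := by
      refine ⟨?_, fun z hz => ?_⟩
      · rw [Finset.disjoint_insert_left]
        refine ⟨fun h => hy ?_, hcpl.1.mono_right
          (Finset.union_subset_union_right (Finset.erase_subset _ _))⟩
        simp only [Finset.mem_union, Finset.mem_erase] at h ⊢
        tauto
      · simp only [Finset.mem_union, Finset.mem_erase, Finset.mem_insert, not_or, not_and,
          ne_eq] at hz ⊢
        rcases eq_or_ne z x with rfl | hzx
        · exact ⟨y, by tauto, hxy⟩
        · obtain ⟨t, ht, hzt⟩ := hdom z hz.1 (hz.2 hzx)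
          exact ⟨t, by tauto, hzt⟩
    have h1 := zeta_le hc
    have h2 := Finset.card_union_le B (C.erase x)
    have h4 := Finset.card_insert_le y A
    omega

theorem perfectRoman_eq_roman_iff_of_maxDegree_add_two (hG : ∀ x, ∃ y, G.Adj x y)
    (hW : 3 ≤ Fintype.card W) (hΔ : H.maxDegree + 2 = Fintype.card W) :
    (G.lexProduct H).perfectRomanDominationNumber = (G.lexProduct H).romanDominationNumber ↔
      ∃ A B : Finset V, G.IsZetaCouple A B ∧ G.IsOpenPacking (A ∪ B) ∧
        (1 ≤ H.minDegree → A = ∅) := by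
  have : Nonempty W := Fintype.card_pos_iff.1 (by omega)
  have hR := romanDominationNumber_lexProduct_eq_zeta (G := G) hW hΔ
  constructor
  · intro heq
    obtain ⟨f, hf, hsum⟩ := (G.lexProduct H).exists_sum_eq_perfectRomanDominationNumber
    have h1 := card_parts_le_sum (f := f) (c := 2) hW
    have hC := onesPart_eq_empty_of_isZetaCouple hG hf.isRomanDominating hΔ.le (by omega)
    have hcpl := isDominatingCouple_parts hf.isRomanDominating hΔ.le
    rw [hC, Finset.union_empty] at hcpl
    have h2 := zeta_le hcpl
    have hle : ∑ p, (f p : ℕ) ≤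
        2 * (lightPart f 2).card + (2 + 1) * (heavyPart f 2).card := by omega
    have hz : G.IsZetaCouple (lightPart f 2) (heavyPart f 2) := ⟨hcpl, by omega⟩
    refine ⟨_, _, hz, ?_, fun hδ => ?_⟩
    · refine isOpenPacking_of_isPerfectRomanDominating hf fun x => ?_
      by_cases hx : x ∈ heavyPart f 2
      · exact Or.inr fun y hy => hz.not_adj hx hy
      · have := fiberWeight_le_two_of_sum_le hW hle hx
        exact Or.inl (by omega)
    · by_contra hne
      obtain ⟨x, hx⟩ := Finset.nonempty_iff_ne_empty.2 hne
      obtain ⟨y, hy, hxy⟩ := hcpl.2 x (Finset.disjoint_left.1 hcpl.1 hx)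
      exact not_adj_of_fiberWeight_le_two hf hδ (Finset.mem_union_left _ hx)
        (mem_lightPart.1 hx).2 (Finset.mem_union.2 hy) hxy
  · rintro ⟨A, B, hz, hS, hA⟩
    refine le_antisymm ?_ (romanDominationNumber_le_perfect _)
    rw [hR, hz.2]
    exact perfectRomanDominationNumber_lexProduct_le hΔ hz.1 hS
      (fun x hx y hy => hz.not_adj hx hy) hA

/-! ### Maximum degree at most `n(H) - 3` -/

lemma totalDominationNumber_le_card_parts (hG : ∀ x, ∃ y, G.Adj x y) {f : V × W → Fin 3}
    (hf : (G.lexProduct H).IsRomanDominating f) (hΔ : H.maxDegree + 3 ≤ Fintype.card W) :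
    G.totalDominationNumber ≤
      (lightPart f 3).card + 2 * (heavyPart f 3).card + (onesPart f).card := by
  have h := totalDominationNumber_le_add hG (P := lightPart f 3 ∪ heavyPart f 3)
    (Q := heavyPart f 3 ∪ onesPart f) fun x hx => by
      rw [Finset.mem_union, not_or] at hx
      exact exists_adj_of_notMem_heavyPart hf hΔ le_rfl hx.1 hx.2
  have h1 := Finset.card_union_le (lightPart f 3) (heavyPart f 3)
  have h2 := Finset.card_union_le (heavyPart f 3) (onesPart f)
  omega

lemma romanDominationNumber_lexProduct_eq_two_mul_totalDominationNumber
    (hG : ∀ x, ∃ y, G.Adj x y) (hΔ : H.maxDegree + 3 ≤ Fintype.card W) :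
    (G.lexProduct H).romanDominationNumber = 2 * G.totalDominationNumber := by
  have : Nonempty W := Fintype.card_pos_iff.1 (by omega)
  apply le_antisymm
  · obtain ⟨S, hS, hcard⟩ := exists_card_eq_totalDominationNumber hG
    have hc : G.IsDominatingCouple S ∅ :=
      ⟨Finset.disjoint_empty_right _, fun x _ => by simpa using hS x⟩
    simpa [hcard] using romanDominationNumber_lexProduct_le (H := H)
      (c := Fintype.card W - H.maxDegree) (by omega) hc
  · obtain ⟨f, hf, hsum⟩ := (G.lexProduct H).exists_sum_eq_romanDominationNumber
    have h1 := card_parts_le_sum (f := f) (c := 3) (by omega)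
    have h2 := totalDominationNumber_le_card_parts hG hf hΔ
    omega

lemma parts_of_perfectRoman_eq_roman (hG : ∀ x, ∃ y, G.Adj x y)
    (hΔ : H.maxDegree + 3 ≤ Fintype.card W) {f : V × W → Fin 3}
    (hf : (G.lexProduct H).IsPerfectRomanDominating f)
    (hsum : ∑ p, (f p : ℕ) = 2 * G.totalDominationNumber) :
    (∀ x, x ∉ heavyPart f 3 → ∃ y ∈ lightPart f 3 ∪ heavyPart f 3, G.Adj x y) ∧
    (∀ x ∈ heavyPart f 3, ∀ y ∈ lightPart f 3 ∪ heavyPart f 3, ¬ G.Adj x y) ∧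
    G.IsOpenPacking (lightPart f 3 ∪ heavyPart f 3) ∧
    (∀ x ∈ heavyPart f 3, fiberWeight f x = 4) ∧
    (∀ x, x ∉ heavyPart f 3 → fiberWeight f x ≤ 2) ∧
    2 * (lightPart f 3).card + 4 * (heavyPart f 3).card = 2 * G.totalDominationNumber := by
  have hW : 3 ≤ Fintype.card W := by omega
  have h1 := card_parts_le_sum (f := f) (c := 3) hW
  have h2 := totalDominationNumber_le_card_parts hG hf.isRomanDominating hΔ
  have hC : onesPart f = ∅ := Finset.card_eq_zero.1 (by omega)
  have hle : ∑ p, (f p : ℕ) ≤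
      2 * (lightPart f 3).card + (3 + 1) * (heavyPart f 3).card := by
    rw [hC, Finset.card_empty] at h2
    omega
  have hdom : ∀ x, x ∉ heavyPart f 3 → ∃ y ∈ lightPart f 3 ∪ heavyPart f 3, G.Adj x y :=
    fun x hx => exists_adj_of_notMem_heavyPart hf.isRomanDominating hΔ le_rfl hx (by simp [hC])
  have hind : ∀ x ∈ heavyPart f 3, ∀ y ∈ lightPart f 3 ∪ heavyPart f 3, ¬ G.Adj x y := by
    intro x hx y hy hxy
    have h := totalDominationNumber_le_add hG (P := lightPart f 3 ∪ heavyPart f 3)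
      (Q := (heavyPart f 3).erase x) fun z hz => by
        rcases eq_or_ne z x with rfl | hzx
        · exact ⟨y, hy, hxy⟩
        · exact hdom z fun h => hz (Finset.mem_erase.2 ⟨hzx, h⟩)
    have h3 := Finset.card_union_le (lightPart f 3) (heavyPart f 3)
    have h4 := Finset.card_erase_add_one hx
    omega
  have hlight := fun x => fiberWeight_le_two_of_sum_le (x := x) hW hle
  refine ⟨hdom, hind, isOpenPacking_of_isPerfectRomanDominating hf fun x => ?_,
    fun x => fiberWeight_eq_of_mem_heavyPart hW hle, hlight, by omega⟩
  by_cases hx : x ∈ heavyPart f 3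
  · exact Or.inr (hind x hx)
  · have := hlight x hx
    exact Or.inl (by omega)

theorem perfectRoman_eq_roman_iff_of_maxDegree_add_three (hG : ∀ x, ∃ y, G.Adj x y)
    (hΔ : H.maxDegree + 3 = Fintype.card W) :
    (G.lexProduct H).perfectRomanDominationNumber = (G.lexProduct H).romanDominationNumber ↔
      (H.minDegree = 0 ∧ G.zetaPrime = ((2 * G.totalDominationNumber : ℕ) : ℕ∞)) ∨
      (1 ≤ H.minDegree ∧ G.totalDominationNumber = 2 * G.perfectDominationNumber ∧
        2 * G.perfectDominationNumber = 2 * G.packingNumber) := by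
  have : Nonempty W := Fintype.card_pos_iff.1 (by omega)
  have hR := romanDominationNumber_lexProduct_eq_two_mul_totalDominationNumber hG hΔ.le
  rw [zetaPrime_eq_two_mul_totalDominationNumber_iff hG]
  constructor
  · intro heq
    obtain ⟨f, hf, hsum⟩ := (G.lexProduct H).exists_sum_eq_perfectRomanDominationNumber
    obtain ⟨hdom, hind, hS, -, hlight, hcard⟩ :=
      parts_of_perfectRoman_eq_roman hG hΔ.le hf (by omega)
    have hD : G.IsDominatingSet (lightPart f 3 ∪ heavyPart f 3) := fun x hx =>
      hdom x fun h => hx (Finset.mem_union_right _ h)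
    have hnot : ∀ x ∈ lightPart f 3, x ∉ heavyPart f 3 := fun x hx =>
      Finset.disjoint_left.1 disjoint_lightPart_heavyPart hx
    rcases Nat.eq_zero_or_pos H.minDegree with hδ | hδ
    · refine Or.inl ⟨hδ, _, hS, hD, ?_⟩
      have h0 : G.isolatedPart (lightPart f 3 ∪ heavyPart f 3) ⊆ heavyPart f 3 := fun x hx => by
        by_contra hxB
        obtain ⟨y, hy, hxy⟩ := hdom x hxB
        exact (mem_isolatedPart.1 hx).2 y hy hxy
      have h0' := Finset.card_le_card h0
      have h1 := Finset.card_union_of_disjoint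
        (disjoint_nonisolatedPart_isolatedPart (G := G) (lightPart f 3 ∪ heavyPart f 3))
      rw [nonisolatedPart_union_isolatedPart] at h1
      have h2 := Finset.card_union_le (lightPart f 3) (heavyPart f 3)
      omega
    · have hA : lightPart f 3 = ∅ := by
        by_contra hne
        obtain ⟨x, hx⟩ := Finset.nonempty_iff_ne_empty.2 hne
        obtain ⟨y, hy, hxy⟩ := hdom x (hnot x hx)
        exact not_adj_of_fiberWeight_le_two hf hδ (Finset.mem_union_left _ hx)
          (hlight x (hnot x hx)) hy hxy
      simp only [hA, Finset.empty_union, Finset.card_empty] at hS hD hind hcard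
      have hP := hS.isPacking hind
      rw [perfectDominationNumber_eq_card hP hD, packingNumber_eq_card hP hD]
      exact Or.inr ⟨hδ, by omega, rfl⟩
  · intro h
    refine le_antisymm ?_ (romanDominationNumber_le_perfect _)
    rw [hR]
    rcases h with ⟨hδ, S, hS, hD, hle⟩ | ⟨hδ, ht, -⟩
    · have := perfectRomanDominationNumber_lexProduct_le hΔ (isDominatingCouple_isolatedPart hD)
        (by rwa [nonisolatedPart_union_isolatedPart])
        (fun x hx y hy => (mem_isolatedPart.1 hx).2 y
          (by rwa [nonisolatedPart_union_isolatedPart] at hy)) (fun h => by omega)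
      omega
    · obtain ⟨D, hD, hcard⟩ := G.exists_card_eq_perfectDominationNumber
      have hP := hD.isPacking hG (by omega)
      have hc : G.IsDominatingCouple ∅ D :=
        ⟨Finset.disjoint_empty_left _, fun x hx => by simpa using (hD x hx).exists⟩
      have := perfectRomanDominationNumber_lexProduct_le hΔ hc
        (by simpa using hP.isOpenPacking)
        (fun x hx y hy => hP.not_adj hx (by simpa using hy)) (fun _ => rfl)
      rw [Finset.card_empty] at this
      omega

/-! ### Maximum degree at most `n(H) - 4` -/

lemma heavyPart_eq_empty_of_perfectRoman_eq_roman (hG : ∀ x, ∃ y, G.Adj x y)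
    (hΔ : H.maxDegree + 4 ≤ Fintype.card W) {f : V × W → Fin 3}
    (hf : (G.lexProduct H).IsPerfectRomanDominating f)
    (hsum : ∑ p, (f p : ℕ) = 2 * G.totalDominationNumber) : heavyPart f 3 = ∅ := by
  obtain ⟨-, hind, -, hheavy, hlight, -⟩ :=
    parts_of_perfectRoman_eq_roman hG (by omega) hf hsum
  by_contra hne
  obtain ⟨x, hx⟩ := Finset.nonempty_iff_ne_empty.2 hne
  obtain ⟨a, ha⟩ := (mem_heavyPart.1 hx).1
  obtain ⟨y, hxy⟩ := hG x
  have hy : y ∉ heavyPart f 3 := fun h => hind x hx y (Finset.mem_union_right _ h) hxy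
  have hwy := hlight y hy
  obtain ⟨t, ht⟩ := exists_eq_zero_of_fiberWeight_lt
    (show fiberWeight f y < Fintype.card W by omega)
  have hdeg := H.degree_le_maxDegree a
  obtain ⟨w, hwa, hw0⟩ := H.exists_not_adj_label_eq_zero (fun w => f (x, w)) ha
    (show H.degree a + 4 ≤ _ by omega) (hheavy x hx).le
  obtain ⟨⟨y', z⟩, hadj, hz⟩ := (hf (x, w) hw0).exists
  rcases hadj with hxy' | ⟨rfl, hwz⟩
  · exact hind x hx y' (mem_lightPart_union_heavyPart.2 ⟨z, hz⟩) hxy'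
  · have : a = z := congrArg Prod.snd
      ((hf (y, t) ht).unique ⟨Or.inl hxy.symm, ha⟩ ⟨Or.inl hxy.symm, hz⟩)
    exact hwa (this ▸ hwz.symm)

theorem perfectRoman_eq_roman_iff_of_maxDegree_add_four_le [Nonempty V]
    (hG : ∀ x, ∃ y, G.Adj x y) (hΔ : H.maxDegree + 4 ≤ Fintype.card W) :
    (G.lexProduct H).perfectRomanDominationNumber = (G.lexProduct H).romanDominationNumber ↔
      G.PropertyOne H := by
  have : Nonempty W := Fintype.card_pos_iff.1 (by omega)
  have hR := romanDominationNumber_lexProduct_eq_two_mul_totalDominationNumber (H := H) hG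
    (by omega)
  constructor
  · intro heq
    obtain ⟨f, hf, hsum⟩ := (G.lexProduct H).exists_sum_eq_perfectRomanDominationNumber
    obtain ⟨hdom, -, hS, -, hlight, -⟩ :=
      parts_of_perfectRoman_eq_roman hG (by omega) hf (by omega)
    have hB := heavyPart_eq_empty_of_perfectRoman_eq_roman hG hΔ hf (by omega)
    have hnot : ∀ x, x ∉ heavyPart f 3 := fun x => by simp [hB]
    refine ⟨?_, _, Set.eq_univ_of_forall fun x => ?_, hS⟩
    · obtain ⟨x, hx, -⟩ := hdom (Classical.arbitrary V) (hnot _)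
      obtain ⟨y, hy, hxy⟩ := hdom x (hnot x)
      exact minDegree_eq_zero_of_adj hf hx (hlight x (hnot x)) hy hxy
    · obtain ⟨y, hy, hxy⟩ := hdom x (hnot x)
      exact Set.mem_biUnion hy hxy.symm
  · rintro ⟨hδ, D, hcov, hD⟩
    refine le_antisymm ?_ (romanDominationNumber_le_perfect _)
    have hcov' : ∀ x, ∃ y ∈ D, G.Adj x y := fun x => by
      have : x ∈ ⋃ u ∈ D, G.neighborSet u := hcov ▸ Set.mem_univ x
      simp only [Set.mem_iUnion, mem_neighborSet, exists_prop] at this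
      obtain ⟨y, hy, hyx⟩ := this
      exact ⟨y, hy, hyx.symm⟩
    have hc : G.IsDominatingCouple D ∅ :=
      ⟨Finset.disjoint_empty_right _, fun x _ => by simpa using hcov' x⟩
    have hS : G.IsOpenPacking (D ∪ ∅) := by rwa [Finset.union_empty]
    have h1 := perfectRomanDominationNumber_lexProduct_le (H := H)
      (c := Fintype.card W - H.maxDegree) (by omega) hc hS (by simp)
      (fun h => by omega)
    obtain ⟨T, hT, hcard⟩ := exists_card_eq_totalDominationNumber hG
    have h2 := IsOpenPacking.card_le hD hT
    simp only [Finset.card_empty, mul_zero, add_zero] at h1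
    omega

end Product

end SimpleGraph

theorem mainTheorem3 {V : Type*} {W : Type*} [Fintype V] [Nontrivial V] [Fintype W]
    [DecidableEq V] (G : SimpleGraph V) (hG : G.Connected)
    (H : SimpleGraph W) [DecidableRel H.Adj] (hH : 3 ≤ Fintype.card W) :
    (H.maxDegree + 1 = Fintype.card W →
      ((G.lexProduct H).perfectRomanDominationNumber = (G.lexProduct H).romanDominationNumber ↔
        G.PropertyTwo H)) ∧
    (H.maxDegree + 2 = Fintype.card W →
      ((G.lexProduct H).perfectRomanDominationNumber = (G.lexProduct H).romanDominationNumber ↔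
        ∃ A B : Finset V, G.IsZetaCouple A B ∧ G.IsOpenPacking (A ∪ B) ∧
          (1 ≤ H.minDegree → A = ∅))) ∧
    (H.maxDegree + 3 = Fintype.card W →
      ((G.lexProduct H).perfectRomanDominationNumber = (G.lexProduct H).romanDominationNumber ↔
        (H.minDegree = 0 ∧ G.zetaPrime = ((2 * G.totalDominationNumber : ℕ) : ℕ∞)) ∨
        (1 ≤ H.minDegree ∧ G.totalDominationNumber = 2 * G.perfectDominationNumber ∧
          2 * G.perfectDominationNumber = 2 * G.packingNumber))) ∧
    (H.maxDegree + 4 ≤ Fintype.card W →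
      ((G.lexProduct H).perfectRomanDominationNumber = (G.lexProduct H).romanDominationNumber ↔
        G.PropertyOne H)) := by
  have hadj : ∀ x, ∃ y, G.Adj x y := hG.preconnected.exists_adj_of_nontrivial
  exact ⟨G.perfectRoman_eq_roman_iff_of_maxDegree_add_one hH,
    G.perfectRoman_eq_roman_iff_of_maxDegree_add_two hadj hH,
    G.perfectRoman_eq_roman_iff_of_maxDegree_add_three hadj,
    G.perfectRoman_eq_roman_iff_of_maxDegree_add_four_le hadj⟩
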